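/- For a finite simple graph $G$ and an integer $\beta \ge 1$, a proper vertex colouring of $G$ is called $\beta$-frugal if every colour appears at most $\beta$ times in the neighbourhood of each vertex, and $\chi_\beta(G)$ denotes the minimum number of colours in a $\beta$-frugal colouring of $G$. Theorem. For every integer $\beta \ge 1$ there exists a constant $c_\beta > 0$, depending only on $\beta$, such that for all integers $\Delta \ge 2$ and $g \ge 3$ there exists a finite simple graph $G$ with maximum degree exactly $\Delta$ and girth (length of a shortest cycle) exactly $g$ such that \[\chi_\beta(G) \ge c_\beta \, \frac{\Delta^{1 + 1/\beta}}{(\log \Delta)^{1/\beta}},\] where $\log$ is the natural logarithm. -/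

import Mathlib

namespace SimpleGraph

/-- A proper colouring is `β`-frugal if every colour appears at most `β` times in the
neighbourhood of each vertex. -/
def Coloring.IsFrugal {V α : Type*} {G : SimpleGraph V} (C : G.Coloring α) (β : ℕ) : Prop :=
  ∀ (v : V) (a : α), {w : V | G.Adj v w ∧ C w = a}.encard ≤ β

/-- `G` has a `β`-frugal proper colouring with (at most) `k` colours. -/
def FrugalColorable {V : Type*} (G : SimpleGraph V) (β k : ℕ) : Prop :=
  ∃ C : G.Coloring (Fin k), C.IsFrugal β

/-- `χ_β(G)`, for a finite graph `G` and `β ≥ 1`: the minimum number of colours in a `β`-frugal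
colouring of `G`. -/
noncomputable def frugalChromaticNumber {V : Type*} [Finite V] (G : SimpleGraph V) (β : ℕ) : ℕ :=
  sInf {k : ℕ | G.FrugalColorable β k}

/-- The minimum defining `χ_β(G)` is taken over a non-empty set: the colouring with pairwise
distinct colours is `β`-frugal. -/
theorem exists_frugalColorable {V : Type*} [Finite V] (G : SimpleGraph V) {β : ℕ} (hβ : 1 ≤ β) :
    ∃ k, G.FrugalColorable β k := by
  obtain ⟨k, ⟨e⟩⟩ := Finite.exists_equiv_fin V
  refine ⟨k, Coloring.mk e fun {u v} h he => G.ne_of_adj h (e.injective he), fun v a => ?_⟩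
  refine le_trans (Set.encard_le_one_iff.2 ?_) (by exact_mod_cast hβ)
  rintro x y ⟨_, hx⟩ ⟨_, hy⟩
  exact e.injective (hx.trans hy.symm)

/-- The minimum defining `χ_β(G)` is attained. -/
theorem frugalColorable_frugalChromaticNumber {V : Type*} [Finite V] (G : SimpleGraph V) {β : ℕ}
    (hβ : 1 ≤ β) : G.FrugalColorable β (G.frugalChromaticNumber β) :=
  Nat.sInf_mem (G.exists_frugalColorable hβ)

end SimpleGraph

/-!
Fix disjoint vertex sets `A` and `X` with `2 * #X ≤ #A`. Among the bipartite graphs between them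
with degrees at most `d` and girth at least `g`, take an edge-maximal one for which the expected
number of bad sets, `expectedFailures`, is less than `1`; a set of `s` unsaturated vertices of `A`
is bad if no neighbourhood of a vertex of `X` meets it in more than `β` vertices. Suppose there
is a bad set. An `x ∈ X` of degree less than `d` could be joined to any unsaturated vertex of `A`
outside a ball around `x` of bounded size, and on average over these choices the expectation does
not increase, contradicting maximality; so every `x ∈ X` has degree `d`, and then the bad set alone
contributes `1` to the expectation. Hence there is no bad set, and every colour of a `β`-frugal
colouring occurs fewer than `s` times on the unsaturated vertices of `A`. Double counting edges
leaves at least `#A - #X` of these, which forces at least `(#A - #X) / s` colours.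

With `#A = 2 * l * s`, `#X = l * s` and success probability `1 / (4 * l)`, the edgeless graph has
expectation less than `1` for `l` a small multiple of the claimed rate. Adding a disjoint cycle and
a disjoint star makes girth and maximum degree exact.
-/

open Finset SimpleGraph

section Girth

variable {V W : Type*} {G : SimpleGraph V} {H : SimpleGraph W}

theorem snd_edge_notMem_edges_tail {u : V} {w : G.Walk u u} (hw : w.IsCycle) :
    s(u, w.snd) ∉ w.tail.edges := by
  rw [← w.cons_tail_eq hw.not_nil, Walk.cons_isCycle_iff] at hw
  exact hw.2

theorem exists_walk_length_add_one_eq_of_mem_edges {a u v : V} {w : G.Walk a a} (hw : w.IsCycle)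
    (he : s(u, v) ∈ w.edges) : ∃ p : G.Walk v u, s(u, v) ∉ p.edges ∧ p.length + 1 = w.length := by
  classical
  have hu : u ∈ w.support := w.fst_mem_support_of_mem_edges he
  wlog hau : a = u generalizing a w
  · simpa using this (hw.rotate hu) ((w.rotate_edges u hu).symm.mem_iff.1 he)
      (Walk.start_mem_support _) rfl
  subst hau
  have hv : v ∈ w.toSubgraph.neighborSet a := by
    rwa [Subgraph.mem_neighborSet, Walk.adj_toSubgraph_iff_mem_edges]
  rw [hw.neighborSet_toSubgraph_endpoint] at hv
  wlog hsnd : v = w.snd generalizing w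
  · obtain rfl : v = w.penultimate := hv.resolve_left hsnd
    simpa using this hw.reverse (by simpa using he) (by simp) (by simp) (by simp)
  subst hsnd
  exact ⟨w.tail, snd_edge_notMem_edges_tail hw, Walk.length_tail_add_one hw.not_nil⟩

theorem mem_edgeSet_of_mem_edges_sup_edge {u v a b : V} {w : (G ⊔ edge u v).Walk a b}
    (h : s(u, v) ∉ w.edges) : ∀ e ∈ w.edges, e ∈ G.edgeSet := by
  intro e he
  have := w.edges_subset_edgeSet he
  rw [edgeSet_sup] at this
  refine this.resolve_right fun he' => h ?_
  rwa [← Set.mem_singleton_iff.1 (edgeSet_edge_subset he')]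

theorem le_egirth_sup_edge {u v : V} {n : ℕ∞} (hG : n ≤ G.egirth)
    (huv : n ≤ G.edist v u + 1) : n ≤ (G ⊔ edge u v).egirth := by
  rw [le_egirth]
  intro a w hw
  by_cases he : s(u, v) ∈ w.edges
  · obtain ⟨p, hp, hlen⟩ := exists_walk_length_add_one_eq_of_mem_edges hw he
    have := (p.transfer G (mem_edgeSet_of_mem_edges_sup_edge hp)).edist_le
    rw [Walk.length_transfer] at this
    calc n ≤ G.edist v u + 1 := huv
      _ ≤ p.length + 1 := by gcongr
      _ = w.length := by rw [← hlen, Nat.cast_add_one]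
  · have hw' := hw.transfer (mem_edgeSet_of_mem_edges_sup_edge he)
    simpa using hG.trans (egirth_le_length hw')

theorem isContained_of_copy_sum_of_eq_inl {U : Type*} {K : SimpleGraph U} (hK : K.Preconnected)
    (f : K.Copy (G ⊕g H)) {u : U} {v : V} (hu : f u = .inl v) : K ⊑ G := by
  have hinl : ∀ x, ∃ y, f x = .inl y := by
    intro x
    have hreach : (G ⊕g H).Reachable (f u) (f x) := (hK u x).map f.toHom
    rcases hx : f x with y | y
    · exact ⟨y, rfl⟩
    · rw [hu, hx] at hreach
      exact absurd hreach (not_reachable_sum_inl_inr v y)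
  choose g hg using hinl
  refine ⟨⟨g, fun {x y} hxy => ?_⟩, fun x y hxy => ?_⟩
  · have : (G ⊕g H).Adj (f x) (f y) := f.toHom.map_adj hxy
    rwa [hg, hg, sum_adj_inl] at this
  · exact f.injective ((hg x).trans ((congrArg Sum.inl hxy).trans (hg y).symm))

theorem isContained_or_of_isContained_sum {U : Type*} {K : SimpleGraph U} (hK : K.Connected)
    (h : K ⊑ G ⊕g H) : K ⊑ G ∨ K ⊑ H := by
  obtain ⟨f⟩ := h
  obtain ⟨u⟩ := hK.nonempty
  rcases hu : f u with v | w
  · exact .inl (isContained_of_copy_sum_of_eq_inl hK.preconnected f hu)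
  · refine .inr (isContained_of_copy_sum_of_eq_inl (H := G) (v := w) (u := u) hK.preconnected
      (Iso.sumComm.toCopy.comp f) ?_)
    simp [hu]

theorem le_egirth_iff_cycleGraph {n : ℕ∞} :
    n ≤ G.egirth ↔ ∀ m : ℕ, 3 ≤ m → cycleGraph m ⊑ G → n ≤ m := by
  rw [le_egirth]
  constructor
  · intro h m hm hc
    obtain ⟨v, p, hp, rfl⟩ := (cycleGraph_isContained_iff hm).1 hc
    exact h v p hp
  · intro h v p hp
    have h3 := hp.three_le_length
    exact h p.length h3 ((cycleGraph_isContained_iff h3).2 ⟨v, p, hp, rfl⟩)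

theorem egirth_sum : (G ⊕g H).egirth = min G.egirth H.egirth := by
  refine le_antisymm (le_min ?_ ?_) ?_
  · exact IsContained.egirth_le ⟨Embedding.sumInl.toCopy⟩
  · exact IsContained.egirth_le ⟨Embedding.sumInr.toCopy⟩
  · refine le_egirth_iff_cycleGraph.2 fun m hm hc => ?_
    obtain ⟨k, rfl⟩ : ∃ k, m = k + 1 := ⟨m - 1, by omega⟩
    obtain h | h := isContained_or_of_isContained_sum cycleGraph_connected hc
    · exact (min_le_left _ _).trans (le_egirth_iff_cycleGraph.1 le_rfl _ hm h)
    · exact (min_le_right _ _).trans (le_egirth_iff_cycleGraph.1 le_rfl _ hm h)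

theorem surjective_of_isRegularOfDegree [G.LocallyFinite] [H.LocallyFinite] [Nonempty V] {d : ℕ}
    (hG : G.IsRegularOfDegree d) (hH : H.IsRegularOfDegree d) (hconn : H.Preconnected)
    (f : G.Copy H) : Function.Surjective f := by
  classical
  have hnbr : ∀ v, (G.neighborFinset v).image f = H.neighborFinset (f v) := by
    refine fun v => Finset.eq_of_subset_of_card_le (fun w hw => ?_) ?_
    · obtain ⟨u, hu, rfl⟩ := Finset.mem_image.1 hw
      rw [mem_neighborFinset] at hu ⊢
      exact f.toHom.map_adj hu
    · refine le_of_eq ?_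
      rw [card_neighborFinset_eq_degree, hH.degree_eq, ← hG.degree_eq v,
        ← card_neighborFinset_eq_degree]
      exact (Finset.card_image_of_injective _ f.injective).symm
  intro w
  have hz : f (Classical.arbitrary V) ∈ Set.range f := ⟨_, rfl⟩
  generalize f (Classical.arbitrary V) = z at hz
  obtain ⟨p⟩ := hconn w z
  induction p with
  | nil => exact hz
  | @cons x y _ hxy p ih =>
    obtain ⟨v, rfl⟩ := ih hz
    have hx : x ∈ (G.neighborFinset v).image f := by
      rw [hnbr, mem_neighborFinset]
      exact hxy.symm
    obtain ⟨u, -, hu⟩ := Finset.mem_image.1 hx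
    exact ⟨u, hu⟩

theorem egirth_cycleGraph {n : ℕ} (hn : 3 ≤ n) : (cycleGraph n).egirth = n := by
  refine le_antisymm ?_ (le_egirth_iff_cycleGraph.2 fun m hm ⟨f⟩ => ?_)
  · exact le_egirth_iff_cycleGraph.1 le_rfl n hn IsContained.rfl
  · obtain ⟨m, rfl⟩ := Nat.exists_eq_add_of_le' hm
    obtain ⟨n, rfl⟩ := Nat.exists_eq_add_of_le' hn
    have hf := surjective_of_isRegularOfDegree (fun _ => cycleGraph_degree_three_le)
      (fun _ => cycleGraph_degree_three_le) cycleGraph_preconnected f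
    simpa using Fintype.card_le_of_surjective f hf

theorem ball_add_two_subset (c : V) (k : ℕ) :
    G.ball c (k + 2) ⊆ ⋃ v ∈ G.ball c (k + 1), insert v (G.neighborSet v) := by
  intro w hw
  rw [mem_ball] at hw
  obtain ⟨p, hp⟩ := exists_walk_of_edist_ne_top hw.ne_top
  simp only [Set.mem_iUnion, exists_prop]
  cases p with
  | nil => exact ⟨c, mem_ball_self (by simp), Set.mem_insert _ _⟩
  | @cons _ v _ h p =>
    refine ⟨v, ?_, Set.mem_insert_of_mem _ h.symm⟩
    rw [← hp, Walk.length_cons] at hw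
    rw [mem_ball]
    refine p.edist_le.trans_lt ?_
    norm_cast at hw ⊢
    omega

theorem ncard_ball_add_one_le [Finite V] {d : ℕ} (hd : ∀ v, (G.neighborSet v).ncard ≤ d) (c : V)
    (k : ℕ) : (G.ball c (k + 1)).ncard ≤ (d + 1) ^ k := by
  induction k with
  | zero => simp
  | succ k ih =>
    lift G.ball c (k + 1) to Finset V using Set.toFinite _ with B hB
    have hsub : G.ball c ((k + 1 : ℕ) + 1) ⊆ ⋃ v ∈ B, insert v (G.neighborSet v) := by
      simpa [← Finset.mem_coe, hB, add_assoc, one_add_one_eq_two] using ball_add_two_subset c k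
    calc (G.ball c ((k + 1 : ℕ) + 1)).ncard
        ≤ (⋃ v ∈ B, insert v (G.neighborSet v)).ncard := Set.ncard_le_ncard hsub
      _ ≤ ∑ v ∈ B, (insert v (G.neighborSet v)).ncard := B.set_ncard_biUnion_le _
      _ ≤ #B * (d + 1) := by
          rw [← smul_eq_mul]
          exact sum_le_card_nsmul _ _ _ fun v _ =>
            (Set.ncard_insert_le _ _).trans (Nat.add_le_add_right (hd v) 1)
      _ ≤ (d + 1) ^ (k + 1) := by
          rw [pow_succ, ← Set.ncard_coe_finset]
          gcongr

end Girth

/-- The probability that at least `j` among `r` independent trials of success probability `p`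
succeed. -/
def binomialTail (p : ℝ) : ℕ → ℕ → ℝ
  | 0, _ => 1
  | _ + 1, 0 => 0
  | j + 1, r + 1 => p * binomialTail p j r + (1 - p) * binomialTail p (j + 1) r

section BinomialTail

variable {p : ℝ}

@[simp]
theorem binomialTail_zero_left (r : ℕ) : binomialTail p 0 r = 1 := by
  cases r <;> rfl

theorem binomialTail_le_one (h0 : 0 ≤ p) (h1 : p ≤ 1) (j r : ℕ) : binomialTail p j r ≤ 1 := by
  induction r generalizing j with
  | zero => cases j <;> simp [binomialTail]
  | succ r ih =>
    cases j with
    | zero => simp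
    | succ j =>
      rw [binomialTail]
      nlinarith [ih j, ih (j + 1)]

theorem binomialTail_succ_left_le (h0 : 0 ≤ p) (h1 : p ≤ 1) (j r : ℕ) :
    binomialTail p (j + 1) r ≤ binomialTail p j r := by
  induction r generalizing j with
  | zero => cases j <;> simp [binomialTail]
  | succ r ih =>
    cases j with
    | zero => simpa using binomialTail_le_one h0 h1 1 (r + 1)
    | succ j =>
      rw [binomialTail, binomialTail]
      nlinarith [ih j, ih (j + 1)]

theorem choose_mul_pow_mul_pow_le_binomialTail (h0 : 0 ≤ p) (h1 : p ≤ 1) (j r : ℕ) :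
    r.choose j * p ^ j * (1 - p) ^ r ≤ binomialTail p j r := by
  have hq : 0 ≤ 1 - p := sub_nonneg.2 h1
  induction r generalizing j with
  | zero => cases j <;> simp [binomialTail]
  | succ r ih =>
    cases j with
    | zero => simpa using pow_le_one₀ hq (sub_le_self 1 h0)
    | succ j =>
      calc ((r + 1).choose (j + 1) : ℝ) * p ^ (j + 1) * (1 - p) ^ (r + 1)
          = p * (r.choose j * p ^ j * (1 - p) ^ r) * (1 - p) +
              (1 - p) * (r.choose (j + 1) * p ^ (j + 1) * (1 - p) ^ r) := by
            rw [Nat.choose_succ_succ]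
            push_cast
            ring
        _ ≤ p * (r.choose j * p ^ j * (1 - p) ^ r) +
              (1 - p) * (r.choose (j + 1) * p ^ (j + 1) * (1 - p) ^ r) := by
            exact add_le_add_left (mul_le_of_le_one_right (by positivity) (sub_le_self 1 h0)) _
        _ ≤ binomialTail p (j + 1) (r + 1) := by
            rw [binomialTail]
            gcongr
            · exact ih j
            · exact ih (j + 1)

variable {α : Type*} [DecidableEq α]

theorem sum_one_sub_binomialTail_le (h0 : 0 ≤ p) (h1 : p ≤ 1) {U S : Finset α}
    (h : p * #U ≤ #(U ∩ S)) (j r : ℕ) :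
    ∑ a ∈ U, (1 - binomialTail p (j - if a ∈ S then 1 else 0) r) ≤
      #U * (1 - binomialTail p j (r + 1)) := by
  rcases j with _ | j
  · simp
  set δ := binomialTail p j r - binomialTail p (j + 1) r with hδ
  have hδ0 : 0 ≤ δ := sub_nonneg.2 (binomialTail_succ_left_le h0 h1 j r)
  have hterm : ∀ a, 1 - binomialTail p (j + 1 - if a ∈ S then 1 else 0) r =
      (1 - binomialTail p (j + 1) r) - if a ∈ S then δ else 0 := by
    intro a
    split_ifs <;> simp [hδ]
  calc ∑ a ∈ U, (1 - binomialTail p (j + 1 - if a ∈ S then 1 else 0) r)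
      = #U * (1 - binomialTail p (j + 1) r) - #(U ∩ S) * δ := by
        simp only [hterm, sum_sub_distrib, sum_ite_mem, sum_const, nsmul_eq_mul]
        ring
    _ ≤ #U * (1 - binomialTail p (j + 1) r) - p * #U * δ := by gcongr
    _ = #U * (1 - binomialTail p (j + 1) (r + 1)) := by
        rw [binomialTail]
        ring

theorem exists_sum_mul_one_sub_binomialTail_le (h0 : 0 ≤ p) (h1 : p ≤ 1) {U : Finset α}
    (hU : U.Nonempty) {F : Finset (Finset α)} (hF : ∀ S ∈ F, p * #U ≤ #(U ∩ S))
    {c : Finset α → ℝ} (hc : ∀ S ∈ F, 0 ≤ c S) (j : Finset α → ℕ) (r : ℕ) :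
    ∃ a ∈ U, ∑ S ∈ F, c S * (1 - binomialTail p (j S - if a ∈ S then 1 else 0) r) ≤
      ∑ S ∈ F, c S * (1 - binomialTail p (j S) (r + 1)) := by
  refine exists_le_of_sum_le hU ?_
  rw [sum_comm, sum_const, nsmul_eq_mul, mul_sum]
  refine sum_le_sum fun S hS => ?_
  rw [← mul_sum, mul_left_comm]
  exact mul_le_mul_of_nonneg_left (sum_one_sub_binomialTail_le h0 h1 (hF S hS) _ _) (hc S hS)

end BinomialTail

section Sparse

variable {V : Type*} {G : SimpleGraph V} {a x v : V} {d g : ℕ}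

/-- Graphs with all degrees at most `d` and girth at least `g`. Degrees are measured by `Set.ncard`,
so that no decidability or local finiteness instances are involved. -/
structure IsSparse (G : SimpleGraph V) (d g : ℕ) : Prop where
  ncard_neighborSet_le (v : V) : (G.neighborSet v).ncard ≤ d
  le_egirth : (g : ℕ∞) ≤ G.egirth

theorem isSparse_bot : IsSparse (⊥ : SimpleGraph V) d g where
  ncard_neighborSet_le v := by simp
  le_egirth := by simp

theorem neighborSet_sup_edge_left (h : x ≠ a) :
    (G ⊔ edge x a).neighborSet x = insert a (G.neighborSet x) := by
  ext v
  simp only [mem_neighborSet, sup_adj, edge_adj, Set.mem_insert_iff]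
  grind

theorem neighborSet_sup_edge_of_ne (hx : v ≠ x) (ha : v ≠ a) :
    (G ⊔ edge x a).neighborSet v = G.neighborSet v := by
  ext w
  simp [edge_adj, hx, ha]

theorem ncard_neighborSet_sup_edge_le (h : x ≠ a) :
    ((G ⊔ edge x a).neighborSet x).ncard ≤ (G.neighborSet x).ncard + 1 := by
  rw [neighborSet_sup_edge_left h]
  exact Set.ncard_insert_le _ _

theorem IsSparse.sup_edge (hG : IsSparse G d g) (hx : (G.neighborSet x).ncard < d)
    (ha : (G.neighborSet a).ncard < d) (hxa : a ∉ G.ball x (g + 1)) :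
    IsSparse (G ⊔ edge x a) d g where
  ncard_neighborSet_le v := by
    have hne : x ≠ a := by
      rintro rfl
      exact hxa (mem_ball_self (by simp))
    by_cases hvx : v = x
    · subst hvx
      exact (ncard_neighborSet_sup_edge_le hne).trans hx
    by_cases hva : v = a
    · subst hva
      rw [edge_comm]
      exact (ncard_neighborSet_sup_edge_le hne.symm).trans ha
    rw [neighborSet_sup_edge_of_ne hvx hva]
    exact hG.ncard_neighborSet_le v
  le_egirth := by
    refine le_egirth_sup_edge hG.le_egirth ?_
    rw [mem_ball, not_lt] at hxa
    exact le_self_add.trans (hxa.trans le_self_add)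

theorem not_adj_of_notMem_ball (hg : 0 < g) (hxa : a ∉ G.ball x (g + 1)) : ¬ G.Adj x a := by
  intro h
  rw [mem_ball, edist_comm, edist_eq_one_iff_adj.2 h] at hxa
  exact hxa (by exact_mod_cast Nat.lt_add_of_pos_left hg)

theorem isBipartiteWith_sup_edge {A X : Set V} (hG : G.IsBipartiteWith A X) (hx : x ∈ X)
    (ha : a ∈ A) : (G ⊔ edge x a).IsBipartiteWith A X where
  disjoint := hG.disjoint
  mem_of_adj v w h := by
    rw [sup_adj, edge_adj] at h
    rcases h with h | ⟨⟨rfl, rfl⟩ | ⟨rfl, rfl⟩, -⟩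
    · exact hG.mem_of_adj h
    · exact .inr ⟨hx, ha⟩
    · exact .inl ⟨ha, hx⟩

theorem isBipartiteWith_bot {A X : Set V} (h : Disjoint A X) :
    (⊥ : SimpleGraph V).IsBipartiteWith A X :=
  ⟨h, fun _ _ h => h.elim⟩

/-- The vertices of `A` that can still receive an edge when the degrees are bounded by `d`. -/
noncomputable def unsaturated (G : SimpleGraph V) (A : Finset V) (d : ℕ) : Finset V :=
  {a ∈ A | (G.neighborSet a).ncard < d}

theorem unsaturated_subset {A : Finset V} : unsaturated G A d ⊆ A :=
  filter_subset _ _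

theorem unsaturated_anti [Finite V] {H : SimpleGraph V} (h : G ≤ H) (A : Finset V) :
    unsaturated H A d ⊆ unsaturated G A d :=
  monotone_filter_right A fun v _ hv =>
    (Set.ncard_le_ncard (neighborSet_mono h v)).trans_lt hv

end Sparse

section Failure

variable {V : Type*} {G : SimpleGraph V} {p : ℝ} {β d g s : ℕ} {a x y : V} {A X S : Finset V}

/-- The probability that `x` ends up with at most `β` neighbours in `S` if it is given random new
neighbours until its degree is `d`, each of them falling into `S` with probability `p`. -/
noncomputable def failureProb (p : ℝ) (β d : ℕ) (G : SimpleGraph V) (S : Finset V) (x : V) : ℝ :=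
  1 - binomialTail p (β + 1 - (G.neighborSet x ∩ S).ncard) (d - (G.neighborSet x).ncard)

theorem failureProb_nonneg (h0 : 0 ≤ p) (h1 : p ≤ 1) : 0 ≤ failureProb p β d G S x :=
  sub_nonneg.2 (binomialTail_le_one h0 h1 _ _)

theorem failureProb_of_saturated (hx : d ≤ (G.neighborSet x).ncard)
    (hS : (G.neighborSet x ∩ S).ncard ≤ β) : failureProb p β d G S x = 1 := by
  rw [failureProb, Nat.sub_eq_zero_of_le hx, Nat.succ_sub hS, binomialTail, sub_zero]

theorem failureProb_bot : failureProb p β d ⊥ S x = 1 - binomialTail p (β + 1) d := by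
  simp [failureProb]

theorem failureProb_sup_edge_left [Finite V] [DecidableEq V] (hne : x ≠ a) (hxa : ¬ G.Adj x a) :
    failureProb p β d (G ⊔ edge x a) S x =
      1 - binomialTail p (β + 1 - (G.neighborSet x ∩ S).ncard - if a ∈ S then 1 else 0)
        (d - (G.neighborSet x).ncard - 1) := by
  have hS : (insert a (G.neighborSet x) ∩ (S : Set V)).ncard =
      (G.neighborSet x ∩ S).ncard + if a ∈ S then 1 else 0 := by
    split_ifs with ha
    · rw [Set.insert_inter_of_mem (by exact_mod_cast ha),
        Set.ncard_insert_of_notMem fun h => hxa h.1]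
    · rw [Set.insert_inter_of_notMem (by exact_mod_cast ha), add_zero]
  rw [failureProb, neighborSet_sup_edge_left hne, hS, Set.ncard_insert_of_notMem (by simpa),
    Nat.sub_add_eq, Nat.sub_add_eq]

theorem failureProb_sup_edge_of_ne (hx : y ≠ x) (ha : y ≠ a) :
    failureProb p β d (G ⊔ edge x a) S y = failureProb p β d G S y := by
  rw [failureProb, neighborSet_sup_edge_of_ne hx ha, failureProb]

/-- The expected number of `s`-subsets of the unsaturated part of `A` in which every `x ∈ X` ends
up with at most `β` neighbours: the potential of the method of conditional expectations. -/
noncomputable def expectedFailures (p : ℝ) (β d s : ℕ) (A X : Finset V) (G : SimpleGraph V) : ℝ :=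
  ∑ S ∈ powersetCard s (unsaturated G A d), ∏ x ∈ X, failureProb p β d G S x

theorem expectedFailures_bot_le (h0 : 0 ≤ p) (h1 : p ≤ 1) :
    expectedFailures p β d s A X ⊥ ≤ (#A).choose s * (1 - binomialTail p (β + 1) d) ^ #X := by
  have hfail : 0 ≤ 1 - binomialTail p (β + 1) d := sub_nonneg.2 (binomialTail_le_one h0 h1 _ _)
  simp only [expectedFailures, failureProb_bot, prod_const, sum_const, card_powersetCard,
    nsmul_eq_mul]
  gcongr
  exact unsaturated_subset

theorem IsSparse.card_le_card_sdiff_inter_add [Finite V] [DecidableEq V] (hG : IsSparse G d g)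
    {U B : Finset V} (hB : (B : Set V) = G.ball x (g + 1)) (hS : S ⊆ U) :
    #S ≤ #((U \ B) ∩ S) + (d + 1) ^ g := by
  have hball : #B ≤ (d + 1) ^ g := by
    rw [← Set.ncard_coe_finset, hB]
    exact ncard_ball_add_one_le hG.ncard_neighborSet_le x g
  calc #S ≤ #((U \ B) ∩ S ∪ B) := card_le_card fun v hv => by
        have := hS hv
        simp only [mem_union, mem_inter, mem_sdiff]
        tauto
    _ ≤ #((U \ B) ∩ S) + #B := card_union_le _ _
    _ ≤ #((U \ B) ∩ S) + (d + 1) ^ g := by gcongr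

theorem expectedFailures_sup_edge_le [Finite V] [DecidableEq V] (h0 : 0 ≤ p) (h1 : p ≤ 1)
    (hx : x ∈ X) (ha : a ∉ X) (hxa : ¬ G.Adj x a) :
    expectedFailures p β d s A X (G ⊔ edge x a) ≤
      ∑ S ∈ powersetCard s (unsaturated G A d), (∏ y ∈ X.erase x, failureProb p β d G S y) *
        (1 - binomialTail p (β + 1 - (G.neighborSet x ∩ S).ncard - if a ∈ S then 1 else 0)
          (d - (G.neighborSet x).ncard - 1)) := by
  calc expectedFailures p β d s A X (G ⊔ edge x a)
      ≤ ∑ S ∈ powersetCard s (unsaturated G A d), ∏ y ∈ X, failureProb p β d (G ⊔ edge x a) S y :=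
        sum_le_sum_of_subset_of_nonneg (powersetCard_mono (unsaturated_anti le_sup_left A))
          fun S _ _ => prod_nonneg fun y _ => failureProb_nonneg h0 h1
    _ = _ := sum_congr rfl fun S _ => by
        have hne : x ≠ a := fun h => ha (h ▸ hx)
        rw [← prod_erase_mul X _ hx, failureProb_sup_edge_left hne hxa]
        congr 1
        refine prod_congr rfl fun y hy => failureProb_sup_edge_of_ne (ne_of_mem_erase hy) ?_
        exact fun h => ha (h ▸ mem_of_mem_erase hy)

theorem exists_expectedFailures_sup_edge_le [Finite V] (h0 : 0 ≤ p) (h1 : p ≤ 1) (hg : 0 < g)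
    (hs : (d + 1) ^ g < s) (hAs : p * #A + (d + 1) ^ g ≤ s) (hAX : Disjoint A X)
    (hG : IsSparse G d g) (hS : S ⊆ unsaturated G A d) (hSs : #S = s) (hx : x ∈ X)
    (hxd : (G.neighborSet x).ncard < d) :
    ∃ a ∈ unsaturated G A d, a ∉ G.ball x (g + 1) ∧
      expectedFailures p β d s A X (G ⊔ edge x a) ≤ expectedFailures p β d s A X G := by
  classical
  obtain ⟨B, hB⟩ := (Set.toFinite (G.ball x (g + 1))).exists_finset_coe
  set U := unsaturated G A d \ B
  have hUA : (#U : ℝ) ≤ #A := by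
    exact_mod_cast card_le_card (sdiff_subset.trans unsaturated_subset)
  have hinter : ∀ T ∈ powersetCard s (unsaturated G A d), p * #A ≤ #(U ∩ T) := by
    intro T hT
    obtain ⟨hTU, rfl⟩ := mem_powersetCard.1 hT
    have : (#T : ℝ) ≤ #(U ∩ T) + (d + 1) ^ g := by
      exact_mod_cast hG.card_le_card_sdiff_inter_add hB hTU
    linarith
  have hUS : 0 < #(U ∩ S) := by
    have : #S ≤ #(U ∩ S) + (d + 1) ^ g := hG.card_le_card_sdiff_inter_add hB hS
    omega
  obtain ⟨a, haU, ha⟩ := exists_sum_mul_one_sub_binomialTail_le h0 h1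
    ((card_pos.1 hUS).mono inter_subset_left)
    (F := powersetCard s (unsaturated G A d))
    (fun T hT => (by gcongr : p * #U ≤ p * #A).trans (hinter T hT))
    (c := fun T => ∏ y ∈ X.erase x, failureProb p β d G T y)
    (fun T _ => prod_nonneg fun y _ => failureProb_nonneg h0 h1)
    (fun T => β + 1 - (G.neighborSet x ∩ T).ncard) (d - (G.neighborSet x).ncard - 1)
  obtain ⟨haU', haB⟩ := mem_sdiff.1 haU
  have hfar : a ∉ G.ball x (g + 1) := by rwa [← hB, mem_coe]
  have haX : a ∉ X := disjoint_left.1 hAX (unsaturated_subset haU')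
  refine ⟨a, haU', hfar,
    (expectedFailures_sup_edge_le h0 h1 hx haX (not_adj_of_notMem_ball hg hfar)).trans
      (ha.trans_eq (sum_congr rfl fun T _ => ?_))⟩
  rw [Nat.sub_add_cancel (Nat.sub_pos_of_lt hxd), ← prod_erase_mul X _ hx, failureProb]

theorem exists_isSparse_forall_lt_ncard [Finite V] (h0 : 0 ≤ p) (h1 : p ≤ 1) (hg : 0 < g)
    (hs : (d + 1) ^ g < s) (hAs : p * #A + (d + 1) ^ g ≤ s) (hAX : Disjoint A X)
    (hlt : (#A).choose s * (1 - binomialTail p (β + 1) d) ^ #X < 1) :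
    ∃ G : SimpleGraph V, G.IsBipartiteWith A X ∧ IsSparse G d g ∧
      ∀ S ⊆ unsaturated G A d, #S = s → ∃ x ∈ X, β < (G.neighborSet x ∩ S).ncard := by
  have hbot : expectedFailures p β d s A X ⊥ < 1 := (expectedFailures_bot_le h0 h1).trans_lt hlt
  obtain ⟨G, -, hmax⟩ := (Set.toFinite {G : SimpleGraph V | G.IsBipartiteWith A X ∧ IsSparse G d g ∧
    expectedFailures p β d s A X G < 1}).exists_le_maximal
    ⟨isBipartiteWith_bot (disjoint_coe.2 hAX), isSparse_bot, hbot⟩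
  obtain ⟨hbip, hG, hexp⟩ := hmax.prop
  refine ⟨G, hbip, hG, fun S hS hSs => ?_⟩
  by_contra! hfail
  have hfull : ∀ x ∈ X, d ≤ (G.neighborSet x).ncard := by
    by_contra! hx
    obtain ⟨x, hx, hxd⟩ := hx
    obtain ⟨a, ha, hxa, hle⟩ :=
      exists_expectedFailures_sup_edge_le (β := β) h0 h1 hg hs hAs hAX hG hS hSs hx hxd
    obtain ⟨haA, had⟩ := mem_filter.1 ha
    have hGle := hmax.le_of_ge ⟨isBipartiteWith_sup_edge hbip hx haA, hG.sup_edge hxd had hxa,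
      hle.trans_lt hexp⟩ le_sup_left
    refine not_adj_of_notMem_ball hg hxa (hGle ?_)
    have hne : x ≠ a := fun h => disjoint_left.1 hAX haA (h ▸ hx)
    simp [edge_adj, hne]
  have hone : ∏ x ∈ X, failureProb p β d G S x = 1 :=
    prod_eq_one fun x hx => failureProb_of_saturated (hfull x hx) (hfail x hx)
  refine hexp.not_ge (hone.symm.le.trans ?_)
  exact single_le_sum (f := fun S => ∏ x ∈ X, failureProb p β d G S x)
    (fun T _ => prod_nonneg fun x _ => failureProb_nonneg h0 h1)
    (mem_powersetCard.2 ⟨hS, hSs⟩)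

end Failure

section Colour

variable {V W : Type*} {G : SimpleGraph V} {H : SimpleGraph W} {β d k s : ℕ} {A X U : Finset V}

theorem degree_eq_ncard_neighborSet (v : V) [Fintype (G.neighborSet v)] :
    G.degree v = (G.neighborSet v).ncard := by
  rw [Set.ncard_eq_toFinset_card', ← card_neighborFinset_eq_degree, neighborFinset]

theorem card_le_card_unsaturated_add [Finite V] (hG : G.IsBipartiteWith A X) (hd : 0 < d)
    (hX : ∀ x ∈ X, (G.neighborSet x).ncard ≤ d) : #A ≤ #(unsaturated G A d) + #X := by
  classical
  have := Fintype.ofFinite V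
  have hsum : d * #{a ∈ A | ¬ (G.neighborSet a).ncard < d} ≤ d * #X := by
    calc d * #{a ∈ A | ¬ (G.neighborSet a).ncard < d}
        ≤ ∑ a ∈ A with ¬ (G.neighborSet a).ncard < d, G.degree a := by
          rw [mul_comm, ← smul_eq_mul]
          refine card_nsmul_le_sum _ _ _ fun a ha => ?_
          rw [degree_eq_ncard_neighborSet]
          exact not_lt.1 (mem_filter.1 ha).2
      _ ≤ ∑ a ∈ A, G.degree a := sum_le_sum_of_subset (filter_subset _ _)
      _ = ∑ x ∈ X, G.degree x := isBipartiteWith_sum_degrees_eq hG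
      _ ≤ d * #X := by
          rw [mul_comm, ← smul_eq_mul]
          refine sum_le_card_nsmul _ _ _ fun x hx => ?_
          rw [degree_eq_ncard_neighborSet]
          exact hX x hx
  rw [← card_filter_add_card_filter_not (s := A) fun a => (G.neighborSet a).ncard < d]
  exact Nat.add_le_add_left (Nat.le_of_mul_le_mul_left hsum hd) _

theorem card_le_frugalChromaticNumber_mul [Finite V] (hβ : 1 ≤ β)
    (hU : ∀ S ⊆ U, #S = s → ∃ x, β < (G.neighborSet x ∩ S).ncard) :
    #U ≤ G.frugalChromaticNumber β * s := by
  obtain ⟨C, hC⟩ := G.frugalColorable_frugalChromaticNumber hβ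
  have hclass : ∀ i ∈ univ, #{a ∈ U | C a = i} ≤ s := by
    intro i _
    by_contra! hlt
    obtain ⟨S, hS, hSs⟩ := exists_subset_card_eq hlt.le
    obtain ⟨x, hx⟩ := hU S (hS.trans (filter_subset _ _)) hSs
    have hsub : G.neighborSet x ∩ S ⊆ {w | G.Adj x w ∧ C w = i} :=
      fun w hw => ⟨hw.1, (mem_filter.1 (hS hw.2)).2⟩
    have hle := (Set.encard_le_encard hsub).trans (hC x i)
    rw [← (Set.toFinite _).cast_ncard_eq, Nat.cast_le] at hle
    exact hx.not_ge hle
  simpa [mul_comm] using card_le_mul_card_image_of_maps_to (fun a _ => mem_univ (C a)) s hclass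

theorem frugalColorable_of_isContained (h : G ⊑ H) (hH : H.FrugalColorable β k) :
    G.FrugalColorable β k := by
  obtain ⟨f⟩ := h
  obtain ⟨C, hC⟩ := hH
  refine ⟨C.comp f.toHom, fun v i => ?_⟩
  rw [← f.injective.encard_image]
  refine (Set.encard_le_encard ?_).trans (hC (f v) i)
  rintro _ ⟨w, ⟨hvw, hw⟩, rfl⟩
  exact ⟨f.toHom.map_adj hvw, hw⟩

theorem frugalChromaticNumber_le_of_isContained [Finite V] [Finite W] (hβ : 1 ≤ β) (h : G ⊑ H) :
    G.frugalChromaticNumber β ≤ H.frugalChromaticNumber β :=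
  Nat.sInf_le (frugalColorable_of_isContained h (H.frugalColorable_frugalChromaticNumber hβ))

theorem one_le_frugalChromaticNumber [Finite V] [Nonempty V] (hβ : 1 ≤ β) :
    1 ≤ G.frugalChromaticNumber β := by
  obtain ⟨C, -⟩ := G.frugalColorable_frugalChromaticNumber hβ
  exact Fin.pos (C (Classical.arbitrary V))

end Colour

section Padding

variable {V W : Type*} {G : SimpleGraph V} {H : SimpleGraph W} {d g : ℕ}

theorem ncard_neighborSet_sum_inl (v : V) :
    ((G ⊕g H).neighborSet (.inl v)).ncard = (G.neighborSet v).ncard := by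
  rw [neighborSet_sum_inl, Set.ncard_image_of_injective _ Sum.inl_injective]

theorem ncard_neighborSet_sum_inr (w : W) :
    ((G ⊕g H).neighborSet (.inr w)).ncard = (H.neighborSet w).ncard := by
  rw [neighborSet_sum_inr, Set.ncard_image_of_injective _ Sum.inr_injective]

theorem IsSparse.sum (hG : IsSparse G d g) (hH : IsSparse H d g) : IsSparse (G ⊕g H) d g where
  ncard_neighborSet_le
    | .inl v => ncard_neighborSet_sum_inl (H := H) v ▸ hG.ncard_neighborSet_le v
    | .inr w => ncard_neighborSet_sum_inr (G := G) w ▸ hH.ncard_neighborSet_le w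
  le_egirth := egirth_sum.symm ▸ le_min hG.le_egirth hH.le_egirth

theorem isSparse_cycleGraph (hd : 2 ≤ d) (hg : 3 ≤ g) : IsSparse (cycleGraph g) d g where
  ncard_neighborSet_le v := by
    obtain ⟨n, rfl⟩ := Nat.exists_eq_add_of_le' hg
    rwa [← degree_eq_ncard_neighborSet, cycleGraph_degree_three_le]
  le_egirth := (egirth_cycleGraph hg).ge

theorem ncard_neighborSet_starGraph_center (n : ℕ) :
    ((starGraph (0 : Fin (n + 1))).neighborSet 0).ncard = n := by
  rw [← degree_eq_ncard_neighborSet, degree_starGraph_center, Fintype.card_fin, Nat.add_sub_cancel]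

theorem isSparse_starGraph : IsSparse (starGraph (0 : Fin (d + 1))) d g where
  ncard_neighborSet_le v := by
    rw [← degree_eq_ncard_neighborSet, ← Nat.lt_succ_iff]
    simpa using (starGraph (0 : Fin (d + 1))).degree_lt_card_verts v
  le_egirth := by simp [(isAcyclic_starGraph _).egirth_eq_top]

/-- The disjoint union of `G` with a `g`-cycle and a star with `d` leaves, which turns upper bounds
`d` on the degrees and lower bounds `g` on the girth into equalities. -/
abbrev padded (G : SimpleGraph V) (d g : ℕ) : SimpleGraph (V ⊕ (Fin g ⊕ Fin (d + 1))) :=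
  G ⊕g (cycleGraph g ⊕g starGraph 0)

theorem isSparse_padded (hG : IsSparse G d g) (hd : 2 ≤ d) (hg : 3 ≤ g) :
    IsSparse (padded G d g) d g :=
  hG.sum ((isSparse_cycleGraph hd hg).sum isSparse_starGraph)

theorem egirth_padded (hG : IsSparse G d g) (hg : 3 ≤ g) : (padded G d g).egirth = g := by
  rw [egirth_sum, egirth_sum, egirth_cycleGraph hg, (isAcyclic_starGraph _).egirth_eq_top,
    min_top_right, min_eq_right hG.le_egirth]

theorem maxDegree_padded [Fintype V] [DecidableRel (padded G d g).Adj]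
    (hG : IsSparse G d g) (hd : 2 ≤ d) (hg : 3 ≤ g) : (padded G d g).maxDegree = d := by
  refine le_antisymm (maxDegree_le_of_forall_degree_le _ _ fun v => ?_) ?_
  · rw [degree_eq_ncard_neighborSet]
    exact (isSparse_padded hG hd hg).ncard_neighborSet_le v
  · refine le_trans (le_of_eq ?_) (degree_le_maxDegree _ (.inr (.inr 0)))
    rw [degree_eq_ncard_neighborSet, ncard_neighborSet_sum_inr, ncard_neighborSet_sum_inr,
      ncard_neighborSet_starGraph_center]

theorem isContained_padded : G ⊑ padded G d g :=
  ⟨Embedding.sumInl.toCopy⟩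

end Padding

section Asymptotics

open Filter

variable {β d l s : ℕ}

theorem choose_mul_le_exp {m : ℕ} (hm : 0 < m) (s : ℕ) :
    ((m * s).choose s : ℝ) ≤ Real.exp (s * (Real.log m + 1)) := by
  calc ((m * s).choose s : ℝ) ≤ ((m * s : ℕ) : ℝ) ^ s / s.factorial := Nat.choose_le_pow_div _ _
    _ = (m : ℝ) ^ s * ((s : ℝ) ^ s / s.factorial) := by
        push_cast
        ring
    _ ≤ (m : ℝ) ^ s * Real.exp s := by
        gcongr
        exact Real.pow_div_factorial_le_exp _ (Nat.cast_nonneg s) _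
    _ = Real.exp (s * (Real.log m + 1)) := by
        rw [mul_add, Real.exp_add, mul_one, Real.exp_nat_mul, Real.exp_log (by positivity)]

theorem choose_mul_one_sub_pow_lt_one {m : ℕ} (hm : 0 < m) (hs : 0 < s) {q : ℝ} (hq : q ≤ 1)
    (h : Real.log m + 1 < l * q) : ((m * s).choose s : ℝ) * (1 - q) ^ (l * s) < 1 := by
  have hpow : (1 - q) ^ (l * s) ≤ Real.exp (-(s * (l * q))) := by
    calc (1 - q) ^ (l * s) ≤ Real.exp (-q) ^ (l * s) :=
          pow_le_pow_left₀ (sub_nonneg.2 hq) (Real.one_sub_le_exp_neg q) _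
      _ = Real.exp (-(s * (l * q))) := by
          rw [← Real.exp_nat_mul]
          push_cast
          ring_nf
  calc ((m * s).choose s : ℝ) * (1 - q) ^ (l * s)
      ≤ Real.exp (s * (Real.log m + 1)) * Real.exp (-(s * (l * q))) :=
        mul_le_mul (choose_mul_le_exp hm s) hpow (pow_nonneg (sub_nonneg.2 hq) _)
          (Real.exp_nonneg _)
    _ = Real.exp (s * (Real.log m + 1 - l * q)) := by
        rw [← Real.exp_add]
        ring_nf
    _ < 1 := by
        rw [Real.exp_lt_one_iff]
        exact mul_neg_of_pos_of_neg (by positivity) (sub_neg.2 h)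

theorem half_pow_div_factorial_le_choose {j : ℕ} (hd : 2 * j ≤ d + 2) :
    ((d : ℝ) / 2) ^ j / j.factorial ≤ d.choose j := by
  refine le_trans ?_ (Nat.pow_le_choose j d)
  gcongr
  rw [div_le_iff₀ two_pos]
  exact_mod_cast (by omega : d ≤ (d + 1 - j) * 2)

theorem one_div_four_mul_le_one (hl : 1 ≤ l) : 1 / (4 * l : ℝ) ≤ 1 := by
  have : (1 : ℝ) ≤ l := by exact_mod_cast hl
  rw [div_le_one (by positivity)]
  linarith

theorem half_le_one_sub_pow (hl : d ≤ l) (hl1 : 1 ≤ l) :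
    (1 / 2 : ℝ) ≤ (1 - 1 / (4 * l)) ^ d := by
  have : (1 : ℝ) ≤ l := by exact_mod_cast hl1
  have hdl : (d : ℝ) ≤ l := by exact_mod_cast hl
  have hp1 : 1 / (4 * l : ℝ) ≤ 1 := one_div_four_mul_le_one hl1
  have hdp : (d : ℝ) * (1 / (4 * l)) ≤ 1 / 4 := by
    rw [mul_one_div, div_le_iff₀ (by positivity)]
    linarith
  calc (1 / 2 : ℝ) ≤ 1 + d * -(1 / (4 * l)) := by linarith
    _ ≤ (1 + -(1 / (4 * l))) ^ d := one_add_mul_le_pow (by linarith) d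
    _ = (1 - 1 / (4 * l)) ^ d := by rw [← sub_eq_add_neg]

theorem mul_pow_div_pow_le_mul_binomialTail (hd : 2 * β ≤ d) (hl : d ≤ l) (hl1 : 1 ≤ l) :
    (2 * 8 ^ (β + 1) * (β + 1).factorial : ℝ)⁻¹ * d ^ (β + 1) / l ^ β ≤
      l * binomialTail (1 / (4 * l)) (β + 1) d := by
  have : (1 : ℝ) ≤ l := by exact_mod_cast hl1
  have hp1 : 1 / (4 * l : ℝ) ≤ 1 := one_div_four_mul_le_one hl1
  calc (2 * 8 ^ (β + 1) * (β + 1).factorial : ℝ)⁻¹ * d ^ (β + 1) / l ^ β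
      = l * (((d : ℝ) / 2) ^ (β + 1) / (β + 1).factorial * (1 / (4 * l)) ^ (β + 1) * (1 / 2)) := by
        have : (8 : ℝ) ^ (β + 1) = 2 ^ (β + 1) * 4 ^ (β + 1) := by
          rw [← mul_pow]
          norm_num
        rw [this, div_pow, div_pow, mul_pow, one_pow, pow_succ (l : ℝ)]
        field_simp
    _ ≤ l * (d.choose (β + 1) * (1 / (4 * l)) ^ (β + 1) * (1 - 1 / (4 * l)) ^ d) := by
        gcongr
        · exact half_pow_div_factorial_le_choose (by omega)
        · exact half_le_one_sub_pow hl hl1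
    _ ≤ l * binomialTail (1 / (4 * l)) (β + 1) d := by
        gcongr
        exact choose_mul_pow_mul_pow_le_binomialTail (by positivity) hp1 _ _

/-- The order of growth of the lower bound on `χ_β` for graphs of maximum degree `d`. -/
noncomputable def frugalRate (β d : ℕ) : ℝ :=
  (d : ℝ) ^ (1 + 1 / (β : ℝ)) / Real.log d ^ (1 / (β : ℝ))

theorem frugalRate_nonneg : 0 ≤ frugalRate β d := by
  have := Real.log_natCast_nonneg d
  unfold frugalRate
  positivity

theorem frugalRate_pow (hβ : β ≠ 0) : frugalRate β d ^ β = d ^ (β + 1) / Real.log d := by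
  have hβ' : (β : ℝ) ≠ 0 := by exact_mod_cast hβ
  rw [frugalRate, div_pow, ← Real.rpow_mul_natCast (Nat.cast_nonneg d),
    ← Real.rpow_mul_natCast (Real.log_natCast_nonneg d), add_mul, one_div,
    inv_mul_cancel₀ hβ', Real.rpow_one, one_mul, ← Nat.cast_add_one, Real.rpow_natCast]

theorem frugalRate_le_sq (hβ : 1 ≤ β) (hlog : 1 ≤ Real.log d) : frugalRate β d ≤ d ^ 2 := by
  have hd : (1 : ℝ) ≤ d := by
    rw [Nat.one_le_cast, Nat.one_le_iff_ne_zero]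
    rintro rfl
    norm_num at hlog
  have hβ' : 1 / (β : ℝ) ≤ 1 := div_le_one_of_le₀ (by exact_mod_cast hβ) (Nat.cast_nonneg β)
  calc frugalRate β d ≤ (d : ℝ) ^ (1 + 1 / (β : ℝ)) :=
        div_le_self (by positivity) (Real.one_le_rpow hlog (by positivity))
    _ ≤ (d : ℝ) ^ ((2 : ℕ) : ℝ) :=
        Real.rpow_le_rpow_of_exponent_le hd (by push_cast; linarith)
    _ = d ^ 2 := Real.rpow_natCast _ _

theorem eventually_one_le_log : ∀ᶠ d : ℕ in atTop, 1 ≤ Real.log d :=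
  (Real.tendsto_log_atTop.comp tendsto_natCast_atTop_atTop).eventually_ge_atTop 1

theorem eventually_le_mul_frugalRate (hβ : β ≠ 0) {c : ℝ} (hc : 0 < c) :
    ∀ᶠ d : ℕ in atTop, (d : ℝ) ≤ c * frugalRate β d := by
  have hlittle := Real.isLittleO_log_id_atTop.bound (pow_pos hc β)
  filter_upwards [eventually_one_le_log, tendsto_natCast_atTop_atTop.eventually hlittle]
    with d hlog1 hlog
  have hlog' : Real.log d ≤ c ^ β * d := (le_abs_self _).trans (by simpa using hlog)
  refine le_of_pow_le_pow_left₀ hβ (mul_nonneg hc.le frugalRate_nonneg) ?_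
  rw [mul_pow, frugalRate_pow hβ, ← mul_div_assoc, le_div_iff₀ (zero_lt_one.trans_le hlog1)]
  calc (d : ℝ) ^ β * Real.log d ≤ d ^ β * (c ^ β * d) := by gcongr
    _ = c ^ β * d ^ (β + 1) := by ring

theorem log_two_mul_add_one_le {x : ℝ} (hx : 0 < x) (hlog : 1 ≤ Real.log d)
    (hxd : 2 * x ≤ d ^ 2) : Real.log (2 * x) + 1 ≤ 3 * Real.log d := by
  calc Real.log (2 * x) + 1 ≤ Real.log ((d : ℝ) ^ 2) + Real.log d := by gcongr
    _ = 3 * Real.log d := by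
        rw [Real.log_pow]
        ring

theorem eight_mul_log_le_mul_pow_div_pow {K : ℝ} (hβ : β ≠ 0) (hK0 : 0 ≤ K) (hK1 : K ≤ 1)
    {x : ℝ} (hx : 0 < x) (hlog : 1 ≤ Real.log d) (hxR : x ≤ K / 8 * frugalRate β d) :
    8 * Real.log d ≤ K * d ^ (β + 1) / x ^ β := by
  have hpow : x ^ β ≤ K / 8 * (d ^ (β + 1) / Real.log d) := by
    calc x ^ β ≤ (K / 8 * frugalRate β d) ^ β := by gcongr
      _ = (K / 8) ^ β * (d ^ (β + 1) / Real.log d) := by rw [mul_pow, frugalRate_pow hβ]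
      _ ≤ K / 8 * (d ^ (β + 1) / Real.log d) := by
          gcongr
          exact pow_le_of_le_one (by positivity) (by linarith) hβ
  rw [le_div_iff₀ (by positivity)]
  calc 8 * Real.log d * x ^ β ≤ 8 * Real.log d * (K / 8 * (d ^ (β + 1) / Real.log d)) := by gcongr
    _ = K * d ^ (β + 1) := by field_simp

theorem exists_eventually_log_lt_mul_binomialTail (hβ : 1 ≤ β) :
    ∃ c : ℝ, 0 < c ∧ ∀ᶠ d : ℕ in atTop, ∃ l : ℕ, 1 ≤ l ∧ c * frugalRate β d ≤ l ∧
      Real.log (2 * l) + 1 < l * binomialTail (1 / (4 * l)) (β + 1) d := by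
  set K : ℝ := (2 * 8 ^ (β + 1) * (β + 1).factorial : ℝ)⁻¹
  have hK0 : 0 < K := by positivity
  have hK1 : K ≤ 1 := by
    refine inv_le_one_of_one_le₀ ?_
    exact_mod_cast (by positivity : 0 < 2 * 8 ^ (β + 1) * (β + 1).factorial)
  refine ⟨K / 16, by positivity, ?_⟩
  filter_upwards [eventually_one_le_log, eventually_ge_atTop (2 * β), eventually_ge_atTop 1,
    eventually_le_mul_frugalRate (β := β) (by omega) (by positivity : 0 < K / 16)]
    with d hlog hdβ hd1 hdR
  set R := frugalRate β d
  have hd1' : (1 : ℝ) ≤ d := by exact_mod_cast hd1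
  have hle : K / 16 * R ≤ ⌈K / 16 * R⌉₊ := Nat.le_ceil _
  have hlt : (⌈K / 16 * R⌉₊ : ℝ) < K / 16 * R + 1 := Nat.ceil_lt_add_one (by linarith)
  set l := ⌈K / 16 * R⌉₊
  have hdl : d ≤ l := by exact_mod_cast hdR.trans hle
  have hl : (0 : ℝ) < l := by exact_mod_cast hd1.trans hdl
  have hl8 : (l : ℝ) ≤ K / 8 * R := by linarith
  have hsq : 2 * (l : ℝ) ≤ d ^ 2 := by
    have hR : R ≤ d ^ 2 := frugalRate_le_sq hβ hlog
    nlinarith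
  refine ⟨l, hd1.trans hdl, hle, ?_⟩
  calc Real.log (2 * l) + 1 ≤ 3 * Real.log d := log_two_mul_add_one_le hl hlog hsq
    _ < 8 * Real.log d := by linarith
    _ ≤ K * d ^ (β + 1) / l ^ β :=
        eight_mul_log_le_mul_pow_div_pow (by omega) hK0.le hK1 hl hlog hl8
    _ ≤ l * binomialTail (1 / (4 * l)) (β + 1) d :=
        mul_pow_div_pow_le_mul_binomialTail hdβ hdl (hd1.trans hdl)

theorem exists_mul_frugalRate_le_one (β N : ℕ) :
    ∃ c : ℝ, 0 < c ∧ ∀ d < N, c * frugalRate β d ≤ 1 := by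
  have hsum : 0 ≤ ∑ d ∈ range N, frugalRate β d := sum_nonneg fun d _ => frugalRate_nonneg
  refine ⟨(1 + ∑ d ∈ range N, frugalRate β d)⁻¹, by positivity, fun d hd => ?_⟩
  rw [inv_mul_le_one₀ (by positivity)]
  have := single_le_sum (f := frugalRate β) (fun d _ => frugalRate_nonneg) (mem_range.2 hd)
  linarith

end Asymptotics

theorem exists_isSparse_le_frugalChromaticNumber {β d g l : ℕ} (hβ : 1 ≤ β) (hd : 0 < d)
    (hg : 0 < g) (hl : 1 ≤ l)
    (h : Real.log (2 * l) + 1 < l * binomialTail (1 / (4 * l)) (β + 1) d) :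
    ∃ (V : Type) (_ : Fintype V) (G : SimpleGraph V),
      IsSparse G d g ∧ l ≤ G.frugalChromaticNumber β := by
  obtain ⟨s, hs⟩ : ∃ s, s = 2 * (d + 1) ^ g := ⟨_, rfl⟩
  have hball : 0 < (d + 1) ^ g := by positivity
  have hs0 : 0 < s := by omega
  let A : Finset (Fin (2 * l * s) ⊕ Fin (l * s)) := univ.map Function.Embedding.inl
  let X : Finset (Fin (2 * l * s) ⊕ Fin (l * s)) := univ.map Function.Embedding.inr
  have hA : #A = 2 * l * s := by simp [A]
  have hX : #X = l * s := by simp [X]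
  have hp0 : 0 ≤ 1 / (4 * l : ℝ) := by positivity
  have hp1 : 1 / (4 * l : ℝ) ≤ 1 := one_div_four_mul_le_one hl
  have hAs : 1 / (4 * l : ℝ) * #A + (d + 1) ^ g ≤ s := by
    rw [hA, hs]
    push_cast
    field_simp
    norm_num
  have hlt : (#A).choose s * (1 - binomialTail (1 / (4 * l)) (β + 1) d) ^ #X < 1 := by
    rw [hA, hX]
    exact choose_mul_one_sub_pow_lt_one (by omega) hs0 (binomialTail_le_one hp0 hp1 _ _)
      (by exact_mod_cast h)
  obtain ⟨G, hbip, hG, hmany⟩ := exists_isSparse_forall_lt_ncard hp0 hp1 hg (by omega) hAs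
    (disjoint_map_inl_map_inr _ _) hlt
  refine ⟨_, inferInstance, G, hG, Nat.le_of_mul_le_mul_right ?_ hs0⟩
  have hU : l * s ≤ #(unsaturated G A d) := by
    have := card_le_card_unsaturated_add hbip hd fun x _ => hG.ncard_neighborSet_le x
    rw [hA, hX] at this
    linarith
  refine hU.trans (card_le_frugalChromaticNumber_mul hβ fun S hS hSs => ?_)
  obtain ⟨x, -, hx⟩ := hmany S hS hSs
  exact ⟨x, hx⟩

theorem exists_isSparse_mul_frugalRate_le {β : ℕ} (hβ : 1 ≤ β) :
    ∃ c : ℝ, 0 < c ∧ ∀ d g : ℕ, 0 < d → 0 < g → ∃ (V : Type) (_ : Fintype V) (G : SimpleGraph V),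
      IsSparse G d g ∧ c * frugalRate β d ≤ G.frugalChromaticNumber β := by
  obtain ⟨c₁, hc₁, hlarge⟩ := exists_eventually_log_lt_mul_binomialTail hβ
  obtain ⟨N, hN⟩ := Filter.eventually_atTop.1 hlarge
  obtain ⟨c₂, hc₂, hsmall⟩ := exists_mul_frugalRate_le_one β N
  refine ⟨min c₁ c₂, lt_min hc₁ hc₂, fun d g hd hg => ?_⟩
  rcases le_or_gt N d with hdN | hdN
  · obtain ⟨l, hl, hcl, hlog⟩ := hN d hdN
    obtain ⟨V, hV, G, hG, hχ⟩ := exists_isSparse_le_frugalChromaticNumber hβ hd hg hl hlog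
    refine ⟨V, hV, G, hG, ?_⟩
    calc min c₁ c₂ * frugalRate β d ≤ c₁ * frugalRate β d :=
          mul_le_mul_of_nonneg_right (min_le_left _ _) frugalRate_nonneg
      _ ≤ l := hcl
      _ ≤ G.frugalChromaticNumber β := by exact_mod_cast hχ
  · refine ⟨Unit, inferInstance, ⊥, isSparse_bot, ?_⟩
    calc min c₁ c₂ * frugalRate β d ≤ c₂ * frugalRate β d :=
          mul_le_mul_of_nonneg_right (min_le_right _ _) frugalRate_nonneg
      _ ≤ 1 := hsmall d hdN
      _ ≤ (⊥ : SimpleGraph Unit).frugalChromaticNumber β := by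
          exact_mod_cast one_le_frugalChromaticNumber hβ

theorem theorem3 (β : ℕ) (hβ : 1 ≤ β) :
    ∃ c : ℝ, 0 < c ∧ ∀ Δ g : ℕ, 2 ≤ Δ → 3 ≤ g →
      ∃ (V : Type) (_ : Fintype V) (G : SimpleGraph V) (_ : DecidableRel G.Adj),
        G.maxDegree = Δ ∧ G.egirth = (g : ℕ∞) ∧
          c * ((Δ : ℝ) ^ (1 + 1 / (β : ℝ)) / (Real.log Δ) ^ (1 / (β : ℝ))) ≤
            (G.frugalChromaticNumber β : ℝ) := by
  obtain ⟨c, hc, h⟩ := exists_isSparse_mul_frugalRate_le hβ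
  refine ⟨c, hc, fun Δ g hΔ hg => ?_⟩
  obtain ⟨V, _, G, hG, hχ⟩ := h Δ g (by omega) (by omega)
  classical
  refine ⟨_, inferInstance, padded G Δ g, Classical.decRel _, maxDegree_padded hG hΔ hg,
    egirth_padded hG hg, hχ.trans ?_⟩
  exact_mod_cast frugalChromaticNumber_le_of_isContained hβ isContained_padded
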